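/- All graphs are simple, locally finite and connected. For a vertex $x$ of a graph $G$ let $m(x)$ be its valence, $\Delta f(x)=\sum_{y\sim x}(f(x)-f(y))$ the combinatorial Laplacian, $d$ the graph distance, $S_r(x_0)=\{x: d(x_0,x)=r\}$ and $\underline m(r)=\min_{x\in S_r(x_0)}m(x)$. The heat kernel of $G$ is $p_t(x,y)=\lim_{R\to\infty}p^R_t(x,y)$, where $p^R_t$ is the kernel of $e^{-t\Delta_R}$ and $\Delta_R$ is the Laplacian on functions vanishing off the interior of the ball of radius $R$ about $x_0$ (the interior consists of the vertices of the ball all of whose neighbours lie in the ball; $p^R_t=0$ off the interior). For $n:\mathbb N_0\to\mathbb N_0$, let $T_n$ be an infinite model tree with root $y_0$ and branching function $n$: a tree in which $y_0$ has valence $n(0)$ and every vertex at distance $r>0$ from $y_0$ has valence $n(r)+1$. Let $\rho_t$ be the heat kernel of $T_n$. Then, for all $t\ge 0$, the value $\rho_t(y_0,y)$ depends only on $r=d(y_0,y)$; denote it by $\rho_t(r)$. Moreover: (1) Let $T$ be a tree and $x_0$ a vertex of $T$. If $n(0)\le m(x_0)$ and $n(r)\le\underline m(r)-1$ for all $r>0$,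 then $T_n$ embeds in $T$ as a subgraph with $y_0$ mapped to $x_0$, and $$p_t(x_0,x)\le\rho_t(r)\qquad\text{for all } t\ge 0,\ r\ge 0,\ x\in S_r(x_0).$$ (2) Let $G$ be a graph and $x_0$ a vertex of $G$. For a vertex $x$, let $m_{+1}(x)$ and $m_{-1}(x)$ be the numbers of neighbours $y$ of $x$ with $d(x_0,y)=d(x_0,x)+1$ and $d(x_0,y)=d(x_0,x)-1$ respectively. If $m_{-1}(x)=1$ for every vertex $x\ne x_0$, and $n(r)\le m_{+1}(x)$ for all $r\ge 0$ and all $x\in S_r(x_0)$, then $$p_t(x_0,x)\le\rho_t(r)\qquad\text{for all } t\ge 0,\ r\ge 0,\ x\in S_r(x_0).$$ -/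

import Mathlib

open Filter

namespace GraphHeat

open scoped Classical in
/-- The combinatorial Laplacian `Δ f (x) = ∑_{y ∼ x} (f x - f y)` of a locally finite graph. -/
noncomputable def laplacian {V : Type*} (G : SimpleGraph V) [G.LocallyFinite]
    (f : V → ℝ) (x : V) : ℝ :=
  ∑ y ∈ G.neighborFinset x, (f x - f y)

open scoped Classical in
/-- The (finite) vertex set of the ball of radius `r` about `o`, built by adding neighbours `r`
times; `mem_ball_iff` identifies it with the metric ball. -/
noncomputable def ball {V : Type*} (G : SimpleGraph V) [G.LocallyFinite] (o : V) :
    ℕ → Finset V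
  | 0 => {o}
  | r + 1 => ball G o r ∪ (ball G o r).biUnion (fun x => G.neighborFinset x)

theorem mem_ball_iff {V : Type*} (G : SimpleGraph V) [G.LocallyFinite] (hG : G.Connected)
    (o x : V) (r : ℕ) : x ∈ ball G o r ↔ G.dist o x ≤ r := by
  induction r generalizing x with
  | zero =>
    simp only [ball, Finset.mem_singleton, Nat.le_zero, hG.dist_eq_zero_iff]
    exact eq_comm
  | succ r ih =>
    simp only [ball, Finset.mem_union, Finset.mem_biUnion, SimpleGraph.mem_neighborFinset, ih]
    constructor
    · rintro (h | ⟨y, hy, hyx⟩)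
      · omega
      · have h1 := hG.dist_triangle (u := o) (v := y) (w := x)
        have h2 : G.dist y x = 1 := SimpleGraph.dist_eq_one_iff_adj.mpr hyx
        omega
    · intro h
      by_cases hr : G.dist o x ≤ r
      · exact Or.inl hr
      · right
        obtain ⟨p, hp⟩ := (hG.preconnected x o).exists_walk_length_eq_dist
        have hxo : G.dist x o = r + 1 := by
          rw [SimpleGraph.dist_comm]; omega
        cases p with
        | nil => simp at hr
        | cons hadj q =>
          rename_i y
          refine ⟨y, ?_, hadj.symm⟩
          have h3 := SimpleGraph.dist_le q
          rw [SimpleGraph.Walk.length_cons] at hp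
          rw [SimpleGraph.dist_comm]
          omega

open scoped Classical in
/-- The interior of a finite vertex set `D`: the vertices of `D` all of whose neighbours are in
`D`. The remaining vertices of `D` form its boundary. -/
noncomputable def interior {V : Type*} (G : SimpleGraph V) [G.LocallyFinite]
    (D : Finset V) : Finset V :=
  D.filter (fun x => G.neighborFinset x ⊆ D)

open scoped Classical in
/-- The matrix, in the basis of delta functions at the interior vertices of `D`, of the reduced
Laplacian of `D`, which acts on the functions vanishing off the interior of `D`. -/
noncomputable def reducedLaplacian {V : Type*} (G : SimpleGraph V) [G.LocallyFinite]
    (D : Finset V) : Matrix (interior G D) (interior G D) ℝ :=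
  fun x y => laplacian G (Pi.single (y : V) (1 : ℝ)) (x : V)

open scoped Classical in
/-- The heat kernel of `D` with Dirichlet boundary conditions: the kernel of `exp (-t Δ_D)` for
the reduced Laplacian `Δ_D`, extended by `0` off the interior of `D`. -/
noncomputable def dirichletHeatKernel {V : Type*} (G : SimpleGraph V) [G.LocallyFinite]
    (D : Finset V) (t : ℝ) (x y : V) : ℝ :=
  if h : x ∈ interior G D ∧ y ∈ interior G D then
    NormedSpace.exp ((-t) • reducedLaplacian G D) ⟨x, h.1⟩ ⟨y, h.2⟩
  else 0

/-- The heat kernel `p_t(x, y)` of `G`: the limit of the Dirichlet heat kernels of the balls of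
radius `r` about the vertex `o`, as `r → ∞` (an increasing, bounded sequence, for `t ≥ 0`). -/
noncomputable def heatKernel {V : Type*} (G : SimpleGraph V) [G.LocallyFinite]
    (o : V) (t : ℝ) (x y : V) : ℝ :=
  limUnder atTop (fun r : ℕ => dirichletHeatKernel G (ball G o r) t x y)

/-- `H` is the model tree with root `y₀` and branching function `n`: the root has valence `n 0`
and a vertex at distance `r > 0` from the root has valence `n r + 1`. -/
structure IsModelTree {W : Type*} (H : SimpleGraph W) [H.LocallyFinite]
    (y₀ : W) (n : ℕ → ℕ) : Prop where
  isTree : H.IsTree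
  degree_root : H.degree y₀ = n 0
  degree_of_pos : ∀ r : ℕ, 0 < r → ∀ y : W, H.dist y₀ y = r → H.degree y = n r + 1

open scoped Classical in
/-- `ρ_t(r)`: the value of `ρ_t(y₀, y)`, where `ρ` is the heat kernel of `H`, at a vertex `y` of
the sphere of radius `r` about `y₀`. -/
noncomputable def radialHeatKernel {W : Type*} (H : SimpleGraph W) [H.LocallyFinite]
    (y₀ : W) (t : ℝ) (r : ℕ) : ℝ :=
  if h : ∃ y : W, H.dist y₀ y = r then heatKernel H y₀ t y₀ h.choose else 0

/-- The minimum of the valence over the sphere of radius `r` about `x₀`. -/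
noncomputable def minValence {V : Type*} (G : SimpleGraph V) [G.LocallyFinite]
    (x₀ : V) (r : ℕ) : ℕ :=
  sInf ((fun x => G.degree x) '' {x : V | G.dist x₀ x = r})

open scoped Classical in
/-- `m_{+1}(x)`: the number of neighbours of `x` that are one step further from `x₀` than `x`. -/
noncomputable def outerDegree {V : Type*} (G : SimpleGraph V) [G.LocallyFinite]
    (x₀ x : V) : ℕ :=
  ((G.neighborFinset x).filter (fun y => G.dist x₀ y = G.dist x₀ x + 1)).card

open scoped Classical in
/-- `m_{-1}(x)`: the number of neighbours of `x` that are one step closer to `x₀` than `x`. -/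
noncomputable def innerDegree {V : Type*} (G : SimpleGraph V) [G.LocallyFinite]
    (x₀ x : V) : ℕ :=
  ((G.neighborFinset x).filter (fun y => G.dist x₀ y + 1 = G.dist x₀ x)).card

end GraphHeat

namespace GraphHeat

/-! On the ball of radius `R` about the root, the Dirichlet heat kernel of the model tree is `u t
(dist y₀ y)`, where `u` solves a finite linear ODE system in the radius with coefficients `n`
(`exists_radial_solution`, `dirichletHeatKernel_eq_radial`). Pulled back to a graph with one inner
neighbour per vertex, `u` fails the heat equation only by `(m₊ - n) * (u r - u (r + 1))`
(`heat_equation_comp_dist`). This is nonnegative, since `u` decreases in `r` (`radial_antitone`); so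
`u` is a supersolution, the parabolic minimum principle puts the Dirichlet kernel of the graph below
it, and `R → ∞` gives the comparison.

In a tree every vertex other than the root has one inner neighbour, so the tree case is a special
case; the embedding is built sphere by sphere. -/

/-! ### Minimum principle and linear flows for finite systems. -/

/-- At a negative space-time minimum of `exp (-(C + 1) t) * z`, left difference quotients are at
most zero, while the hypothesis makes the derivative positive. The rate `C + 1` instead of `C` is
what makes it strictly positive. -/
theorem nonneg_of_deriv_ge_at_min {ι : Type*} (s : Finset ι) (C : ℝ) (z z' : ℝ → ι → ℝ)
    (hd : ∀ t, 0 ≤ t → ∀ i ∈ s, HasDerivAt (fun τ => z τ i) (z' t i) t)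
    (h0 : ∀ i ∈ s, 0 ≤ z 0 i)
    (h : ∀ t, 0 ≤ t → ∀ i ∈ s, z t i < 0 → (∀ j ∈ s, z t i ≤ z t j) → C * z t i ≤ z' t i) :
    ∀ t, 0 ≤ t → ∀ i ∈ s, 0 ≤ z t i := by
  intro T hT k hk
  by_contra! hneg
  set y : ℝ → ι → ℝ := fun t i => Real.exp (-(C + 1) * t) * z t i with hy
  have hyd : ∀ t, 0 ≤ t → ∀ i ∈ s, HasDerivAt (fun τ => y τ i)
      (Real.exp (-(C + 1) * t) * (z' t i - (C + 1) * z t i)) t := by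
    intro t ht i hi
    have h1 : HasDerivAt (fun τ : ℝ => Real.exp (-(C + 1) * τ))
        (Real.exp (-(C + 1) * t) * (-(C + 1) * 1)) t :=
      ((hasDerivAt_id t).const_mul _).exp
    refine (h1.mul (hd t ht i hi)).congr_deriv ?_
    ring
  have hmin : ∀ i ∈ s, ∃ τ ∈ Set.Icc (0 : ℝ) T, ∀ σ ∈ Set.Icc (0 : ℝ) T, y τ i ≤ y σ i := by
    intro i hi
    have hc : ContinuousOn (fun τ => y τ i) (Set.Icc 0 T) := fun t ht =>
      (hyd t ht.1 i hi).continuousAt.continuousWithinAt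
    obtain ⟨τ, hτ, hm⟩ := isCompact_Icc.exists_isMinOn ⟨0, le_refl _, hT⟩ hc
    exact ⟨τ, hτ, fun σ hσ => hm hσ⟩
  choose! τ hτ hτm using hmin
  obtain ⟨i, hi, him⟩ := s.exists_min_image (fun i => y (τ i) i) ⟨k, hk⟩
  have hle : ∀ σ ∈ Set.Icc (0 : ℝ) T, ∀ j ∈ s, y (τ i) i ≤ y σ j := fun σ hσ j hj =>
    (him j hj).trans (hτm j hj σ hσ)
  have hyneg : y (τ i) i < 0 := (hle T ⟨hT, le_refl _⟩ k hk).trans_lt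
    (mul_neg_of_pos_of_neg (Real.exp_pos _) hneg)
  have hzneg : z (τ i) i < 0 := by
    by_contra! hz
    exact absurd hyneg (not_lt.2 (mul_nonneg (Real.exp_pos _).le hz))
  have hτ0 : 0 < τ i := by
    refine lt_of_le_of_ne (hτ i hi).1 fun h' => ?_
    rw [← h'] at hzneg
    exact absurd hzneg (not_lt.2 (h0 i hi))
  have hzmin : ∀ j ∈ s, z (τ i) i ≤ z (τ i) j := fun j hj =>
    le_of_mul_le_mul_left (hle (τ i) (hτ i hi) j hj) (Real.exp_pos _)
  have hz' := h (τ i) hτ0.le i hi hzneg hzmin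
  have hpos : 0 < Real.exp (-(C + 1) * τ i) * (z' (τ i) i - (C + 1) * z (τ i) i) :=
    mul_pos (Real.exp_pos _) (by linarith)
  have hsl := (hyd (τ i) hτ0.le i hi).tendsto_slope.mono_left
    (nhdsWithin_mono (τ i) (fun σ (hσ : σ ∈ Set.Iio (τ i)) => ne_of_lt hσ))
  have hev : ∀ᶠ σ in nhdsWithin (τ i) (Set.Iio (τ i)), σ ∈ Set.Ioo 0 (τ i) :=
    Ioo_mem_nhdsLT hτ0
  obtain ⟨σ, hσ1, hσ2⟩ := ((hsl.eventually (lt_mem_nhds hpos)).and hev).exists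
  rw [slope_def_field] at hσ1
  have h2 := hle σ ⟨hσ2.1.le, hσ2.2.le.trans (hτ i hi).2⟩ i hi
  exact absurd hσ1 (not_lt.2 (div_nonpos_of_nonneg_of_nonpos (by linarith) (by linarith [hσ2.2])))

theorem exists_linear_flow {ι : Type*} [Fintype ι] (A : (ι → ℝ) →ₗ[ℝ] (ι → ℝ)) (z₀ : ι → ℝ) :
    ∃ z : ℝ → ι → ℝ, z 0 = z₀ ∧
      ∀ t i, HasDerivAt (fun τ => z τ i) (A (z t) i) t := by
  let L : (ι → ℝ) →L[ℝ] (ι → ℝ) := LinearMap.toContinuousLinearMap A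
  refine ⟨fun t => NormedSpace.exp (t • L) z₀, by simp, fun t i => ?_⟩
  have h1 := (hasDerivAt_exp_smul_const' (𝕂 := ℝ) L t).clm_apply (hasDerivAt_const t z₀)
  simp only [map_zero, add_zero] at h1
  exact (hasDerivAt_pi.1 h1) i

/-! ### Dirichlet heat kernels: heat equation, comparison, monotonicity in the domain. -/

section Dirichlet

variable {V : Type*} (G : SimpleGraph V) [G.LocallyFinite]

theorem laplacian_single [DecidableEq V] (x y : V) :
    laplacian G (Pi.single y (1 : ℝ)) x = laplacian G (Pi.single x (1 : ℝ)) y := by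
  classical
  by_cases hxy : x = y
  · rw [hxy]
  · simp [laplacian, Pi.single_apply, hxy, Ne.symm hxy, G.adj_comm]

theorem laplacian_eq_sum_single [DecidableEq V] (I : Finset V) (f : V → ℝ)
    (hf : ∀ y ∉ I, f y = 0) (x : V) :
    laplacian G f x = ∑ y : I, f y * laplacian G (Pi.single (y : V) (1 : ℝ)) x := by
  classical
  rw [Finset.sum_coe_sort I (fun y => f y * laplacian G (Pi.single (y : V) (1 : ℝ)) x)]
  have key : ∀ w, f w = ∑ y ∈ I, f y * (Pi.single y (1 : ℝ) : V → ℝ) w := by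
    intro w
    by_cases hw : w ∈ I
    · simp [Pi.single_apply, hw]
    · simp [Pi.single_apply, hw, hf w hw]
  simp only [laplacian, Finset.mul_sum]
  rw [Finset.sum_comm]
  refine Finset.sum_congr rfl fun w _ => ?_
  rw [key x, key w, ← Finset.sum_sub_distrib]
  exact Finset.sum_congr rfl fun y _ => (mul_sub _ _ _).symm

theorem dirichletHeatKernel_of_notMem {D : Finset V} {x y : V} (t : ℝ)
    (h : y ∉ interior G D) : dirichletHeatKernel G D t x y = 0 :=
  dif_neg fun h' => h h'.2

theorem dirichletHeatKernel_of_notMem_left {D : Finset V} {x y : V} (t : ℝ)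
    (h : x ∉ interior G D) : dirichletHeatKernel G D t x y = 0 :=
  dif_neg fun h' => h h'.1

open scoped Classical in
theorem dirichletHeatKernel_zero {D : Finset V} {x : V} (hx : x ∈ interior G D) (y : V) :
    dirichletHeatKernel G D 0 x y = if x = y then 1 else 0 := by
  by_cases hy : y ∈ interior G D
  · rw [dirichletHeatKernel, dif_pos ⟨hx, hy⟩]
    simp [Matrix.one_apply]
  · rw [dirichletHeatKernel_of_notMem G _ hy, if_neg]
    rintro rfl
    exact hy hx

-- Differentiating the exponential with the generator on the right makes it act on the second
-- variable; symmetry of the matrix turns the resulting sum into a Laplacian. The local norm only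
-- serves to make matrices a normed algebra.
attribute [local instance] Matrix.linftyOpNormedRing Matrix.linftyOpNormedAlgebra in
theorem hasDerivAt_dirichletHeatKernel {D : Finset V} (x : V) {y : V}
    (hy : y ∈ interior G D) (t : ℝ) :
    HasDerivAt (fun τ => dirichletHeatKernel G D τ x y)
      (-laplacian G (dirichletHeatKernel G D t x) y) t := by
  classical
  by_cases hx : x ∈ interior G D
  · have h1 := hasDerivAt_exp_smul_const (𝕂 := ℝ) (-reducedLaplacian G D) t
    have h2 := hasDerivAt_pi.1 (hasDerivAt_pi.1 h1 ⟨x, hx⟩) ⟨y, hy⟩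
    have h3 : (fun τ => dirichletHeatKernel G D τ x y) =
        fun τ => NormedSpace.exp (τ • -reducedLaplacian G D) ⟨x, hx⟩ ⟨y, hy⟩ := by
      funext τ
      rw [dirichletHeatKernel, dif_pos ⟨hx, hy⟩, smul_neg, neg_smul]
    rw [h3]
    refine h2.congr_deriv (Eq.symm ?_)
    rw [laplacian_eq_sum_single G (interior G D) _
      (fun w hw => dirichletHeatKernel_of_notMem (x := x) G t hw) y, Matrix.mul_neg,
      Matrix.neg_apply, Matrix.mul_apply]
    congr 1
    refine Finset.sum_congr rfl fun w _ => ?_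
    rw [dirichletHeatKernel, dif_pos ⟨hx, w.2⟩, smul_neg, neg_smul, laplacian_single]
    congr 1
  · simp only [dirichletHeatKernel_of_notMem_left G _ hx, laplacian, sub_self,
      Finset.sum_const_zero, neg_zero]
    exact hasDerivAt_const _ _

/-- Parabolic minimum principle. -/
theorem nonneg_of_supersolution (I : Finset V) (v v' : ℝ → V → ℝ)
    (hd : ∀ t, 0 ≤ t → ∀ x ∈ I, HasDerivAt (fun τ => v τ x) (v' t x) t)
    (h0 : ∀ x ∈ I, 0 ≤ v 0 x) (hI : ∀ t, 0 ≤ t → ∀ x ∉ I, 0 ≤ v t x)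
    (h : ∀ t, 0 ≤ t → ∀ x ∈ I, -laplacian G (v t) x ≤ v' t x) (t : ℝ) (ht : 0 ≤ t) (x : V) :
    0 ≤ v t x := by
  by_cases hx : x ∈ I
  · refine nonneg_of_deriv_ge_at_min I 0 v v' hd h0 (fun t ht x hx hneg hmin => ?_) t ht x hx
    refine le_trans ?_ (h t ht x hx)
    rw [zero_mul, le_neg, neg_zero]
    refine Finset.sum_nonpos fun y _ => sub_nonpos.2 ?_
    by_cases hy : y ∈ I
    · exact hmin y hy
    · exact hneg.le.trans (hI t ht y hy)
  · exact hI t ht x hx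

theorem laplacian_sub (f g : V → ℝ) (x : V) :
    laplacian G (fun y => f y - g y) x = laplacian G f x - laplacian G g x := by
  simp only [laplacian, ← Finset.sum_sub_distrib]
  exact Finset.sum_congr rfl fun _ _ => by ring

theorem dirichletHeatKernel_nonneg (D : Finset V) {t : ℝ} (ht : 0 ≤ t) (x y : V) :
    0 ≤ dirichletHeatKernel G D t x y := by
  classical
  by_cases hx : x ∈ interior G D
  · refine nonneg_of_supersolution G (interior G D) (fun t y => dirichletHeatKernel G D t x y)
      (fun t y => -laplacian G (dirichletHeatKernel G D t x) y)
      (fun t _ y hy => hasDerivAt_dirichletHeatKernel G x hy t) (fun y _ => ?_)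
      (fun t _ y hy => (dirichletHeatKernel_of_notMem G t hy).ge) (fun _ _ _ _ => le_rfl) t ht y
    rw [dirichletHeatKernel_zero G hx]
    split_ifs <;> simp
  · exact (dirichletHeatKernel_of_notMem_left G t hx).ge

theorem dirichletHeatKernel_le_of_supersolution (D : Finset V) (x : V) (v v' : ℝ → V → ℝ)
    (hd : ∀ t, 0 ≤ t → ∀ y ∈ interior G D, HasDerivAt (fun τ => v τ y) (v' t y) t)
    (h0 : 1 ≤ v 0 x) (hv : ∀ t, 0 ≤ t → ∀ y, 0 ≤ v t y)
    (h : ∀ t, 0 ≤ t → ∀ y ∈ interior G D, -laplacian G (v t) y ≤ v' t y)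
    (t : ℝ) (ht : 0 ≤ t) (y : V) :
    dirichletHeatKernel G D t x y ≤ v t y := by
  classical
  by_cases hx : x ∈ interior G D
  · refine sub_nonneg.1 (nonneg_of_supersolution G (interior G D)
      (fun t y => v t y - dirichletHeatKernel G D t x y)
      (fun t y => v' t y - -laplacian G (dirichletHeatKernel G D t x) y)
      (fun t ht y hy => (hd t ht y hy).sub (hasDerivAt_dirichletHeatKernel G x hy t))
      (fun y _ => ?_) (fun t ht y hy => ?_) (fun t ht y hy => ?_) t ht y)
    · rw [dirichletHeatKernel_zero G hx]
      split_ifs with hxy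
      · rw [← hxy]; linarith
      · linarith [hv 0 le_rfl y]
    · simp only [dirichletHeatKernel_of_notMem G t hy, sub_zero]
      exact hv t ht y
    · rw [laplacian_sub]
      linarith [h t ht y hy]
  · rw [dirichletHeatKernel_of_notMem_left G t hx]
    exact hv t ht y

theorem le_dirichletHeatKernel_of_subsolution (D : Finset V) {x : V} (hx : x ∈ interior G D)
    (v v' : ℝ → V → ℝ)
    (hd : ∀ t, 0 ≤ t → ∀ y ∈ interior G D, HasDerivAt (fun τ => v τ y) (v' t y) t)
    (h0 : v 0 x ≤ 1) (h0' : ∀ y, y ≠ x → v 0 y ≤ 0)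
    (hv : ∀ t, 0 ≤ t → ∀ y ∉ interior G D, v t y ≤ 0)
    (h : ∀ t, 0 ≤ t → ∀ y ∈ interior G D, v' t y ≤ -laplacian G (v t) y)
    (t : ℝ) (ht : 0 ≤ t) (y : V) :
    v t y ≤ dirichletHeatKernel G D t x y := by
  classical
  refine sub_nonneg.1 (nonneg_of_supersolution G (interior G D)
    (fun t y => dirichletHeatKernel G D t x y - v t y)
    (fun t y => -laplacian G (dirichletHeatKernel G D t x) y - v' t y)
    (fun t ht y hy => (hasDerivAt_dirichletHeatKernel G x hy t).sub (hd t ht y hy))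
    (fun y _ => ?_) (fun t ht y hy => ?_) (fun t ht y hy => ?_) t ht y)
  · rw [dirichletHeatKernel_zero G hx]
    split_ifs with hxy
    · rw [← hxy]; linarith
    · linarith [h0' y (Ne.symm hxy)]
  · simp only [dirichletHeatKernel_of_notMem G t hy]
    linarith [hv t ht y hy]
  · rw [laplacian_sub]
    linarith [h t ht y hy]

theorem dirichletHeatKernel_le_one (D : Finset V) {t : ℝ} (ht : 0 ≤ t) (x y : V) :
    dirichletHeatKernel G D t x y ≤ 1 :=
  dirichletHeatKernel_le_of_supersolution G D x (fun _ _ => 1) (fun _ _ => 0)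
    (fun _ _ _ _ => hasDerivAt_const _ _) le_rfl (fun _ _ _ => zero_le_one)
    (fun _ _ _ _ => by simp [laplacian]) t ht y

theorem interior_mono {D D' : Finset V} (h : D ⊆ D') : interior G D ⊆ interior G D' := by
  classical
  intro x hx
  simp only [interior, Finset.mem_filter] at hx ⊢
  exact ⟨h hx.1, hx.2.trans h⟩

theorem dirichletHeatKernel_mono {D D' : Finset V} (h : D ⊆ D') {t : ℝ} (ht : 0 ≤ t) (x y : V) :
    dirichletHeatKernel G D t x y ≤ dirichletHeatKernel G D' t x y := by
  classical
  by_cases hx : x ∈ interior G D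
  · exact dirichletHeatKernel_le_of_supersolution G D x
      (fun t y => dirichletHeatKernel G D' t x y)
      (fun t y => -laplacian G (dirichletHeatKernel G D' t x) y)
      (fun t _ y hy => hasDerivAt_dirichletHeatKernel G x (interior_mono G h hy) t)
      (by rw [dirichletHeatKernel_zero G (interior_mono G h hx), if_pos rfl])
      (fun t ht y => dirichletHeatKernel_nonneg G D' ht x y) (fun _ _ _ _ => le_rfl) t ht y
  · rw [dirichletHeatKernel_of_notMem_left G t hx]
    exact dirichletHeatKernel_nonneg G D' ht x y

theorem ball_mono (o : V) : Monotone (ball G o) := by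
  classical
  refine monotone_nat_of_le_succ fun r => ?_
  rw [ball]
  convert Finset.subset_union_left

/-- Monotonicity in the domain and the bound by `1` make the `limUnder` in `heatKernel` a genuine
limit. -/
theorem tendsto_dirichletHeatKernel (o : V) {t : ℝ} (ht : 0 ≤ t) (x y : V) :
    Tendsto (fun r : ℕ => dirichletHeatKernel G (ball G o r) t x y) atTop
      (nhds (heatKernel G o t x y)) := by
  have hm : Monotone (fun r : ℕ => dirichletHeatKernel G (ball G o r) t x y) := fun r s hrs =>
    dirichletHeatKernel_mono G (ball_mono G o hrs) ht x y
  have hb : BddAbove (Set.range fun r : ℕ => dirichletHeatKernel G (ball G o r) t x y) :=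
    ⟨1, by rintro _ ⟨r, rfl⟩; exact dirichletHeatKernel_le_one G _ ht x y⟩
  exact tendsto_nhds_limUnder ⟨_, tendsto_atTop_ciSup hm hb⟩

end Dirichlet

/-! ### The radial heat equation. -/

/-- The solution of the radial heat equation, with Dirichlet boundary condition at radius `R`. -/
theorem exists_radial_solution (n : ℕ → ℕ) (R : ℕ) :
    ∃ u : ℝ → ℕ → ℝ, (∀ t r, R ≤ r → u t r = 0) ∧
      (∀ r, r < R → u 0 r = if r = 0 then 1 else 0) ∧
      ∀ t r, r < R → HasDerivAt (fun τ => u τ r)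
        (n r * (u t (r + 1) - u t r) + if r = 0 then 0 else u t (r - 1) - u t r) t := by
  let ext : (Fin R → ℝ) →ₗ[ℝ] (ℕ → ℝ) :=
    { toFun := fun φ r => if h : r < R then φ ⟨r, h⟩ else 0
      map_add' := fun φ ψ => by ext r; by_cases h : r < R <;> simp [h]
      map_smul' := fun c φ => by ext r; by_cases h : r < R <;> simp [h] }
  have hext : ∀ φ r (h : r < R), ext φ r = φ ⟨r, h⟩ := fun φ r h => dif_pos h
  let A : (Fin R → ℝ) →ₗ[ℝ] (Fin R → ℝ) :=
    { toFun := fun φ i => n i * (ext φ (i + 1) - ext φ i) +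
        if (i : ℕ) = 0 then 0 else ext φ (i - 1) - ext φ i
      map_add' := fun φ ψ => by
        ext i
        simp only [map_add, Pi.add_apply]
        split_ifs <;> ring
      map_smul' := fun c φ => by
        ext i
        simp only [map_smul, Pi.smul_apply, smul_eq_mul, RingHom.id_apply]
        split_ifs <;> ring }
  obtain ⟨z, hz0, hz⟩ := exists_linear_flow A (fun i => if (i : ℕ) = 0 then 1 else 0)
  refine ⟨fun t => ext (z t), fun t r hr => dif_neg (not_lt.2 hr), fun r hr => ?_,
    fun t r hr => ?_⟩
  · simp only [hext _ r hr, hz0]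
  · simp only [hext _ r hr]
    refine (hz t ⟨r, hr⟩).congr_deriv ?_
    simp only [A, LinearMap.coe_mk, AddHom.coe_mk, hext _ r hr]

section Radial

variable {n : ℕ → ℕ} {R : ℕ} {u : ℝ → ℕ → ℝ}

/-- The differences `u t r - u t (r + 1)` themselves obey the minimum principle: at a negative
minimum, their neighbouring differences are no smaller. -/
theorem radial_antitone (hR : ∀ t r, R ≤ r → u t r = 0)
    (h0 : ∀ r, r < R → u 0 r = if r = 0 then 1 else 0)
    (hd : ∀ t r, r < R → HasDerivAt (fun τ => u τ r)
      (n r * (u t (r + 1) - u t r) + if r = 0 then 0 else u t (r - 1) - u t r) t)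
    {t : ℝ} (ht : 0 ≤ t) : Antitone (u t) := by
  set d : ℝ → ℕ → ℝ := fun t r => if r < R then
    n r * (u t (r + 1) - u t r) + (if r = 0 then 0 else u t (r - 1) - u t r) else 0 with hddef
  have hd' : ∀ t r, HasDerivAt (fun τ => u τ r) (d t r) t := by
    intro t r
    by_cases hr : r < R
    · simp only [hddef, hr, if_true]
      exact hd t r hr
    · simp only [hddef, hr, if_false, hR _ r (not_lt.1 hr)]
      exact hasDerivAt_const _ _
  have h0' : ∀ r, u 0 (r + 1) = 0 := fun r => by
    by_cases hr : r + 1 < R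
    · simp [h0 _ hr]
    · exact hR _ _ (not_lt.1 hr)
  -- The sum dominates each `n (r + 1)` in the outer term; the `1` accounts for the inner term.
  set C : ℝ := 1 + ∑ r ∈ Finset.range R, (n (r + 1) : ℝ) with hC
  have hsum : ∀ r < R, (n (r + 1) : ℝ) ≤ ∑ r ∈ Finset.range R, (n (r + 1) : ℝ) := fun r hr =>
    Finset.single_le_sum (f := fun r => (n (r + 1) : ℝ)) (fun _ _ => Nat.cast_nonneg _)
      (Finset.mem_range.2 hr)
  refine antitone_nat_of_succ_le fun r => ?_
  by_cases hr : r < R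
  swap
  · rw [hR t r (not_lt.1 hr), hR t (r + 1) (by omega)]
  refine sub_nonneg.1 (nonneg_of_deriv_ge_at_min (Finset.range R) C
    (fun t r => u t r - u t (r + 1)) (fun t r => d t r - d t (r + 1))
    (fun t _ r _ => (hd' t r).sub (hd' t (r + 1))) (fun r hr => ?_)
    (fun t _ r hr hneg hmin => ?_) t ht r (Finset.mem_range.2 hr))
  · rw [h0', sub_zero, h0 r (Finset.mem_range.1 hr)]
    split_ifs <;> simp
  · have hrR := Finset.mem_range.1 hr
    have hin : u t r - u t (r + 1) ≤ if r = 0 then 0 else u t (r - 1) - u t r := by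
      split_ifs with hr0
      · exact hneg.le
      · have := hmin (r - 1) (Finset.mem_range.2 (by omega))
        simpa only [Nat.sub_add_cancel (Nat.pos_of_ne_zero hr0)] using this
    have hn : 0 ≤ (n r : ℝ) * (u t (r + 1) - u t r) :=
      mul_nonneg (Nat.cast_nonneg _) (by linarith)
    have hdr : d t r = n r * (u t (r + 1) - u t r) +
        if r = 0 then 0 else u t (r - 1) - u t r := if_pos hrR
    have hout : d t (r + 1) ≤ -(C - 1) * (u t r - u t (r + 1)) := by
      by_cases hr1 : r + 1 < R
      · have h1 : d t (r + 1) = n (r + 1) * (u t (r + 1 + 1) - u t (r + 1)) +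
            (u t r - u t (r + 1)) := by simp [hddef, hr1]
        have h2 := mul_le_mul_of_nonneg_left (hmin (r + 1) (Finset.mem_range.2 hr1))
          (Nat.cast_nonneg (α := ℝ) (n (r + 1)))
        have h3 := mul_le_mul_of_nonpos_right (hsum r hrR) hneg.le
        rw [h1, hC]
        linarith
      · have h1 : d t (r + 1) = 0 := if_neg hr1
        rw [h1, neg_mul, le_neg, neg_zero]
        refine mul_nonpos_of_nonneg_of_nonpos ?_ hneg.le
        rw [hC, add_sub_cancel_left]
        exact Finset.sum_nonneg fun _ _ => Nat.cast_nonneg _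
    show C * (u t r - u t (r + 1)) ≤ d t r - d t (r + 1)
    rw [hdr]
    linarith

end Radial

/-! ### Distance spheres and the Laplacian of radial functions. -/

section Distance

theorem exists_inner {V : Type*} {G : SimpleGraph V} {x₀ : V} (hG : G.Connected) {x : V}
    (hx : x ≠ x₀) :
    ∃ y, G.Adj x y ∧ G.dist x₀ y + 1 = G.dist x₀ x := by
  obtain ⟨p, hp⟩ := hG.exists_walk_length_eq_dist x x₀
  cases p with
  | nil => exact absurd rfl hx
  | cons hadj q =>
    rename_i y
    refine ⟨y, hadj, ?_⟩
    have h3 := SimpleGraph.dist_le q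
    rw [SimpleGraph.Walk.length_cons] at hp
    rw [SimpleGraph.dist_comm, SimpleGraph.dist_comm (v := x)]
    have h1 := hG.dist_triangle (u := x) (v := y) (w := x₀)
    have h2 : G.dist x y = 1 := SimpleGraph.dist_eq_one_iff_adj.mpr hadj
    omega

variable {V : Type*} (G : SimpleGraph V) [G.LocallyFinite] (x₀ : V)

/-- Neighbours on the same sphere contribute nothing. At distance `0` the truncated `- 1` makes the
inner term vanish. -/
theorem laplacian_comp_dist (φ : ℕ → ℝ) (x : V) :
    laplacian G (fun y => φ (G.dist x₀ y)) x =
      outerDegree G x₀ x * (φ (G.dist x₀ x) - φ (G.dist x₀ x + 1)) +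
      innerDegree G x₀ x * (φ (G.dist x₀ x) - φ (G.dist x₀ x - 1)) := by
  classical
  have h : ∀ y ∈ G.neighborFinset x, φ (G.dist x₀ x) - φ (G.dist x₀ y) =
      (if G.dist x₀ y = G.dist x₀ x + 1 then φ (G.dist x₀ x) - φ (G.dist x₀ x + 1) else 0) +
      (if G.dist x₀ y + 1 = G.dist x₀ x then φ (G.dist x₀ x) - φ (G.dist x₀ x - 1) else 0) := by
    intro y hy
    have hadj : G.Adj x y := by simpa using hy
    rcases hadj.diff_dist_adj (u := x₀) with h | h | h
    · rw [if_neg (by omega), if_neg (by omega), h]; ring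
    · rw [if_pos h, if_neg (by omega), h]; ring
    · rw [h]
      by_cases hx : G.dist x₀ x = 0
      · simp [hx]
      · rw [if_neg (by omega), if_pos (by omega), zero_add]
  rw [laplacian, Finset.sum_congr rfl h, Finset.sum_add_distrib, ← Finset.sum_filter,
    ← Finset.sum_filter, Finset.sum_const, Finset.sum_const, nsmul_eq_mul, nsmul_eq_mul,
    outerDegree, innerDegree]

theorem innerDegree_self : innerDegree G x₀ x₀ = 0 := by
  simp [innerDegree]

theorem exists_outer_of_outerDegree_pos {x : V} (h : 0 < outerDegree G x₀ x) :
    ∃ y, G.Adj x y ∧ G.dist x₀ y = G.dist x₀ x + 1 := by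
  obtain ⟨y, hy⟩ := Finset.card_pos.1 h
  exact ⟨y, by simpa using hy⟩

theorem outerDegree_pos {x y : V} (h : G.Adj x y) (hd : G.dist x₀ y = G.dist x₀ x + 1) :
    0 < outerDegree G x₀ x :=
  Finset.card_pos.2 ⟨y, by simp [h, hd]⟩

variable {G x₀}

theorem inner_unique {x y z : V} (h : innerDegree G x₀ x = 1) (hy : G.Adj x y)
    (hyd : G.dist x₀ y + 1 = G.dist x₀ x) (hz : G.Adj x z)
    (hzd : G.dist x₀ z + 1 = G.dist x₀ x) : y = z := by
  obtain ⟨w, hw⟩ := Finset.card_eq_one.1 h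
  have h1 : ∀ v, G.Adj x v ∧ G.dist x₀ v + 1 = G.dist x₀ x → v = w := fun v hv => by
    rw [← Finset.mem_singleton, ← hw]
    simpa using hv
  rw [h1 y ⟨hy, hyd⟩, h1 z ⟨hz, hzd⟩]

/-- A vertex on the bounding sphere has an outer neighbour, which leaves the ball; a dead end there
would be interior. -/
theorem mem_interior_ball_iff (hG : G.Connected) (hout : ∀ x, 0 < outerDegree G x₀ x)
    (R : ℕ) (x : V) : x ∈ interior G (ball G x₀ R) ↔ G.dist x₀ x < R := by
  classical
  simp only [interior, Finset.mem_filter, mem_ball_iff G hG, Finset.subset_iff,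
    SimpleGraph.mem_neighborFinset]
  constructor
  · rintro ⟨_, h⟩
    obtain ⟨y, hxy, hy⟩ := exists_outer_of_outerDegree_pos G x₀ (hout x)
    have := h hxy
    omega
  · intro h
    refine ⟨h.le, fun y hxy => ?_⟩
    rcases hxy.diff_dist_adj (u := x₀) with h | h | h <;> omega

theorem exists_dist_eq (hG : G.Connected) [Infinite V] (r : ℕ) : ∃ y, G.dist x₀ y = r := by
  obtain ⟨y, hy⟩ := Infinite.exists_notMem_finset (ball G x₀ r)
  rw [mem_ball_iff G hG, not_le] at hy
  obtain ⟨k, hk⟩ := Nat.exists_eq_add_of_lt hy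
  clear hy
  induction k generalizing y with
  | zero =>
    obtain ⟨z, -, hz⟩ := exists_inner (x₀ := x₀) hG (x := y) (by rintro rfl; simp at hk)
    exact ⟨z, by omega⟩
  | succ k ih =>
    obtain ⟨z, -, hz⟩ := exists_inner (x₀ := x₀) hG (x := y) (by rintro rfl; simp at hk)
    exact ih z (by omega)

/-- The left side is the time derivative of the radial solution, so the last term is its defect in
the heat equation. -/
theorem heat_equation_comp_dist {n : ℕ → ℕ} {u : ℝ → ℕ → ℝ} (hG : G.Connected)
    (hin : ∀ x, x ≠ x₀ → innerDegree G x₀ x = 1) (t : ℝ) (x : V) :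
    n (G.dist x₀ x) * (u t (G.dist x₀ x + 1) - u t (G.dist x₀ x)) +
        (if G.dist x₀ x = 0 then 0 else u t (G.dist x₀ x - 1) - u t (G.dist x₀ x)) =
      -laplacian G (fun y => u t (G.dist x₀ y)) x +
        ((outerDegree G x₀ x : ℝ) - n (G.dist x₀ x)) *
          (u t (G.dist x₀ x) - u t (G.dist x₀ x + 1)) := by
  rw [laplacian_comp_dist]
  by_cases hx : x = x₀
  · subst hx
    rw [innerDegree_self, if_pos SimpleGraph.dist_self]
    push_cast
    ring
  · rw [hin x hx, if_neg (hG.pos_dist_of_ne (Ne.symm hx)).ne']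
    push_cast
    ring

end Distance

/-! ### Comparison of heat kernels with the radial solution. -/

section Comparison

variable {n : ℕ → ℕ} {R : ℕ} {u : ℝ → ℕ → ℝ}

theorem dirichletHeatKernel_le_radial {V : Type*} {G : SimpleGraph V} [G.LocallyFinite] {x₀ : V}
    (hG : G.Connected) (hin : ∀ x, x ≠ x₀ → innerDegree G x₀ x = 1)
    (hout : ∀ x, n (G.dist x₀ x) ≤ outerDegree G x₀ x) (hn : ∀ r, 0 < n r) (hRpos : 0 < R)
    (hR : ∀ t r, R ≤ r → u t r = 0)
    (h0 : ∀ r, r < R → u 0 r = if r = 0 then 1 else 0)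
    (hd : ∀ t r, r < R → HasDerivAt (fun τ => u τ r)
      (n r * (u t (r + 1) - u t r) + if r = 0 then 0 else u t (r - 1) - u t r) t)
    {t : ℝ} (ht : 0 ≤ t) (x : V) :
    dirichletHeatKernel G (ball G x₀ R) t x₀ x ≤ u t (G.dist x₀ x) := by
  have hint := mem_interior_ball_iff hG (fun x => (hn _).trans_le (hout x)) R
  refine dirichletHeatKernel_le_of_supersolution G _ x₀ (fun t x => u t (G.dist x₀ x)) _
    (fun t _ y hy => hd t _ ((hint y).1 hy)) ?_ (fun t ht y => ?_) (fun t ht y _ => ?_) t ht x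
  · simp [h0 0 hRpos]
  -- Nonnegativity: `u t` is decreasing and vanishes from `R` on.
  · rw [← hR t (G.dist x₀ y + R) (by omega)]
    exact radial_antitone hR h0 hd ht (by omega)
  · rw [heat_equation_comp_dist hG hin]
    refine le_add_of_nonneg_right (mul_nonneg (sub_nonneg.2 (Nat.cast_le.2 (hout y)))
      (sub_nonneg.2 (radial_antitone hR h0 hd ht (by omega))))

/-- With outer degree equal to `n` the defect vanishes, so the radial solution is a subsolution as
well. -/
theorem dirichletHeatKernel_eq_radial {W : Type*} {H : SimpleGraph W} [H.LocallyFinite] {y₀ : W}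
    (hH : H.Connected) (hin : ∀ y, y ≠ y₀ → innerDegree H y₀ y = 1)
    (hout : ∀ y, outerDegree H y₀ y = n (H.dist y₀ y)) (hn : ∀ r, 0 < n r) (hRpos : 0 < R)
    (hR : ∀ t r, R ≤ r → u t r = 0)
    (h0 : ∀ r, r < R → u 0 r = if r = 0 then 1 else 0)
    (hd : ∀ t r, r < R → HasDerivAt (fun τ => u τ r)
      (n r * (u t (r + 1) - u t r) + if r = 0 then 0 else u t (r - 1) - u t r) t)
    {t : ℝ} (ht : 0 ≤ t) (y : W) :
    dirichletHeatKernel H (ball H y₀ R) t y₀ y = u t (H.dist y₀ y) := by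
  have hint := mem_interior_ball_iff hH (fun x => (hn _).trans_le (hout x).ge) R
  refine le_antisymm (dirichletHeatKernel_le_radial hH hin (fun y => (hout y).ge) hn hRpos hR h0
    hd ht y) ?_
  refine le_dirichletHeatKernel_of_subsolution H _ ((hint y₀).2 (by simpa using hRpos))
    (fun t x => u t (H.dist y₀ x)) _
    (fun t _ y hy => hd t _ ((hint y).1 hy)) ?_ (fun y hy => ?_) (fun t _ y hy => ?_)
    (fun t ht y _ => ?_) t ht y
  · simp [h0 0 hRpos]
  · by_cases hyR : H.dist y₀ y < R
    · rw [h0 _ hyR, if_neg (hH.pos_dist_of_ne hy.symm).ne']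
    · exact (hR _ _ (not_lt.1 hyR)).le
  · rw [hint, not_lt] at hy
    exact (hR _ _ hy).le
  · rw [heat_equation_comp_dist hH hin, hout, sub_self, zero_mul, add_zero]

theorem dirichletHeatKernel_le_model {V W : Type*} {G : SimpleGraph V} [G.LocallyFinite] {x₀ : V}
    {H : SimpleGraph W} [H.LocallyFinite] {y₀ : W}
    (hH : H.Connected) (hHin : ∀ y, y ≠ y₀ → innerDegree H y₀ y = 1)
    (hHout : ∀ y, outerDegree H y₀ y = n (H.dist y₀ y)) (hn : ∀ r, 0 < n r)
    (hG : G.Connected) (hin : ∀ x, x ≠ x₀ → innerDegree G x₀ x = 1)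
    (hout : ∀ x, n (G.dist x₀ x) ≤ outerDegree G x₀ x)
    {t : ℝ} (ht : 0 ≤ t) {x : V} {y : W} (hxy : G.dist x₀ x = H.dist y₀ y) (hR : 0 < R) :
    dirichletHeatKernel G (ball G x₀ R) t x₀ x ≤ dirichletHeatKernel H (ball H y₀ R) t y₀ y := by
  obtain ⟨u, hu, h0, hd⟩ := exists_radial_solution n R
  rw [dirichletHeatKernel_eq_radial hH hHin hHout hn hR hu h0 hd ht y, ← hxy]
  exact dirichletHeatKernel_le_radial hG hin hout hn hR hu h0 hd ht x

theorem heatKernel_le_model {V W : Type*} {G : SimpleGraph V} [G.LocallyFinite] {x₀ : V}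
    {H : SimpleGraph W} [H.LocallyFinite] {y₀ : W}
    (hH : H.Connected) (hHin : ∀ y, y ≠ y₀ → innerDegree H y₀ y = 1)
    (hHout : ∀ y, outerDegree H y₀ y = n (H.dist y₀ y)) (hn : ∀ r, 0 < n r)
    (hG : G.Connected) (hin : ∀ x, x ≠ x₀ → innerDegree G x₀ x = 1)
    (hout : ∀ x, n (G.dist x₀ x) ≤ outerDegree G x₀ x)
    {t : ℝ} (ht : 0 ≤ t) {x : V} {y : W} (hxy : G.dist x₀ x = H.dist y₀ y) :
    heatKernel G x₀ t x₀ x ≤ heatKernel H y₀ t y₀ y :=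
  le_of_tendsto_of_tendsto (tendsto_dirichletHeatKernel G x₀ ht x₀ x)
    (tendsto_dirichletHeatKernel H y₀ ht y₀ y)
    ((eventually_gt_atTop 0).mono fun _ hR =>
      dirichletHeatKernel_le_model hH hHin hHout hn hG hin hout ht hxy hR)

end Comparison

/-! ### Trees, the embedding, and model trees. -/

section Tree

variable {V : Type*} {T : SimpleGraph V} [T.LocallyFinite] (x₀ : V)

theorem innerDegree_eq_one_of_isTree (hT : T.IsTree) {x : V} (hx : x ≠ x₀) :
    innerDegree T x₀ x = 1 := by
  classical
  obtain ⟨y, hxy, hy⟩ := exists_inner hT.connected hx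
  -- Each inner neighbour is the penultimate vertex of a geodesic to `x`, and paths in a tree are
  -- unique.
  have hpath : ∀ z, T.Adj x z → T.dist x₀ z + 1 = T.dist x₀ x →
      ∃ p : T.Walk x₀ x, p.IsPath ∧ p.penultimate = z := by
    intro z hxz hz
    obtain ⟨p, hp⟩ := hT.connected.exists_walk_length_eq_dist x₀ z
    refine ⟨p.concat hxz.symm, SimpleGraph.Walk.isPath_of_length_eq_dist _ ?_, by simp⟩
    rw [SimpleGraph.Walk.length_concat, hp, hz]
  refine Finset.card_eq_one.2 ⟨y, Finset.ext fun z => ?_⟩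
  simp only [Finset.mem_filter, SimpleGraph.mem_neighborFinset, Finset.mem_singleton]
  refine ⟨fun ⟨hxz, hz⟩ => ?_, fun h => h ▸ ⟨hxy, hy⟩⟩
  obtain ⟨p, hp, rfl⟩ := hpath z hxz hz
  obtain ⟨q, hq, rfl⟩ := hpath y hxy hy
  rw [(hT.existsUnique_path x₀ x).unique hp hq]

theorem degree_eq_outerDegree_add_innerDegree (hT : T.IsTree) (x : V) :
    T.degree x = outerDegree T x₀ x + innerDegree T x₀ x := by
  classical
  rw [outerDegree, innerDegree, ← T.card_neighborFinset_eq_degree,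
    ← Finset.card_union_of_disjoint]
  · congr 1
    ext y
    simp only [Finset.mem_union, Finset.mem_filter, ← and_or_left, SimpleGraph.mem_neighborFinset]
    refine (and_iff_left_of_imp fun h => ?_).symm
    rcases hT.dist_eq_dist_add_one_of_adj x₀ h with h | h
    · exact Or.inr h.symm
    · exact Or.inl h
  · refine Finset.disjoint_filter.2 fun y _ h => ?_
    omega

theorem exists_injOn_mapsTo_of_card_le {α β : Type*} [Nonempty β] (s : Finset α) (t : Finset β)
    (h : s.card ≤ t.card) :
    ∃ e : α → β, Set.InjOn e s ∧ ∀ a ∈ s, e a ∈ t := by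
  classical
  have h' : Fintype.card s ≤ Fintype.card t := by simpa using h
  obtain ⟨g⟩ := Function.Embedding.nonempty_of_card_le h'
  refine ⟨fun a => if ha : a ∈ s then g ⟨a, ha⟩ else Classical.arbitrary β, fun a ha b hb hab => ?_,
    fun a ha => by simp [ha]⟩
  have ha' : a ∈ s := ha
  have hb' : b ∈ s := hb
  simp only [ha', hb', dif_pos] at hab
  simpa using g.injective (Subtype.ext hab)

theorem exists_tree_embedding {W : Type*} {H : SimpleGraph W} [H.LocallyFinite] {y₀ : W}
    (hH : H.IsTree) (hin : ∀ x, x ≠ x₀ → innerDegree T x₀ x = 1)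
    (hout : ∀ y x, H.dist y₀ y = T.dist x₀ x → outerDegree H y₀ y ≤ outerDegree T x₀ x) :
    ∃ f : H →g T, Function.Injective f ∧ f y₀ = x₀ := by
  classical
  have : Nonempty V := ⟨x₀⟩
  -- For vertices at equal distance from their roots, `e` injects the outer neighbours of `y` into
  -- those of `x`.
  have hstep : ∀ (y : W) (x : V), ∃ e : W → V, H.dist y₀ y = T.dist x₀ x →
      Set.InjOn e {w | H.Adj y w ∧ H.dist y₀ w = H.dist y₀ y + 1} ∧
      ∀ w, H.Adj y w → H.dist y₀ w = H.dist y₀ y + 1 →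
        T.Adj x (e w) ∧ T.dist x₀ (e w) = T.dist x₀ x + 1 := by
    intro y x
    by_cases hyx : H.dist y₀ y = T.dist x₀ x
    · obtain ⟨e, he, hem⟩ := exists_injOn_mapsTo_of_card_le _ _ (hout y x hyx)
      refine ⟨e, fun _ => ⟨fun a ha b hb => he (by simpa using ha) (by simpa using hb),
        fun w hw hwd => by simpa using hem w (by simp [hw, hwd])⟩⟩
    · exact ⟨fun _ => x₀, fun h => absurd h hyx⟩
  choose e he using hstep
  have hpar : ∀ y, ∃ p, y ≠ y₀ → H.Adj y p ∧ H.dist y₀ p + 1 = H.dist y₀ y := fun y => by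
    by_cases hy : y = y₀
    · exact ⟨y, fun h => absurd hy h⟩
    · obtain ⟨p, hp⟩ := exists_inner hH.connected hy
      exact ⟨p, fun _ => hp⟩
  choose par hpar using hpar
  -- `F r` matters only on the sphere of radius `r`: the injection chosen for the parent and its
  -- image decides where `y` goes.
  let F : ℕ → W → V := fun r => Nat.rec (fun _ => x₀) (fun _ g y => e (par y) (g (par y)) y) r
  have hFs : ∀ r y, F (r + 1) y = e (par y) (F r (par y)) y := fun _ _ => rfl
  have hne : ∀ {r y}, H.dist y₀ y = r + 1 → y ≠ y₀ := by
    rintro r y hy rfl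
    simp at hy
  have hFd : ∀ r y, H.dist y₀ y = r → T.dist x₀ (F r y) = r := by
    intro r
    induction r with
    | zero => exact fun _ _ => SimpleGraph.dist_self
    | succ r ih =>
      intro y hy
      obtain ⟨h1, h2⟩ := hpar y (hne hy)
      have h3 := ih (par y) (by omega)
      rw [hFs, ((he (par y) _ (by omega)).2 y h1.symm (by omega)).2, h3]
  have hFadj : ∀ r y, H.dist y₀ y = r + 1 → T.Adj (F r (par y)) (F (r + 1) y) := by
    intro r y hy
    obtain ⟨h1, h2⟩ := hpar y (hne hy)
    have h3 := hFd r (par y) (by omega)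
    exact ((he (par y) _ (by omega)).2 y h1.symm (by omega)).1
  have hFinj : ∀ r y z, H.dist y₀ y = r → H.dist y₀ z = r → F r y = F r z → y = z := by
    intro r
    induction r with
    | zero =>
      intro y z hy hz _
      rw [← hH.connected.dist_eq_zero_iff.1 hy, ← hH.connected.dist_eq_zero_iff.1 hz]
    | succ r ih =>
      intro y z hy hz hyz
      obtain ⟨h1, h2⟩ := hpar y (hne hy)
      obtain ⟨h1', h2'⟩ := hpar z (hne hz)
      have h3 := hFd r (par y) (by omega)
      have h3' := hFd r (par z) (by omega)
      have h4 := hFd (r + 1) y hy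
      have hx : F (r + 1) y ≠ x₀ := fun h => by
        rw [h, SimpleGraph.dist_self] at h4
        omega
      -- A common image has a unique inner neighbour, so the parents have equal images and coincide
      -- by induction; the injection at that parent then separates `y` from `z`.
      have hpp : par y = par z := ih _ _ (by omega) (by omega)
        (inner_unique (hin _ hx) (hFadj r y hy).symm (by omega)
          (hyz ▸ (hFadj r z hz).symm) (by omega))
      rw [hFs, hFs, ← hpp] at hyz
      exact (he (par y) _ (by omega)).1 ⟨h1.symm, by omega⟩ ⟨hpp ▸ h1'.symm, by omega⟩ hyz
  have hadj : ∀ y z, H.Adj y z → H.dist y₀ z = H.dist y₀ y + 1 →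
      T.Adj (F (H.dist y₀ y) y) (F (H.dist y₀ z) z) := by
    intro y z hyz hd
    obtain ⟨h1, h2⟩ := hpar z (hne hd)
    have hp : par z = y := inner_unique (innerDegree_eq_one_of_isTree y₀ hH (hne hd)) h1 h2
      hyz.symm hd.symm
    have := hFadj _ z hd
    rwa [hp, ← hd] at this
  refine ⟨⟨fun y => F (H.dist y₀ y) y, fun {y z} hyz => ?_⟩, fun y z hyz => ?_, ?_⟩
  · rcases hH.dist_eq_dist_add_one_of_adj y₀ hyz with h | h
    · exact (hadj z y hyz.symm h).symm
    · exact hadj y z hyz h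
  · have hyz' : F (H.dist y₀ y) y = F (H.dist y₀ z) z := hyz
    have h := hFd _ y rfl
    rw [hyz', hFd _ z rfl] at h
    exact hFinj _ y z rfl h (by rw [hyz', h])
  · show F (H.dist y₀ y₀) y₀ = x₀
    rw [SimpleGraph.dist_self]
    rfl

theorem IsModelTree.outerDegree_eq {W : Type*} {H : SimpleGraph W} [H.LocallyFinite] {y₀ : W}
    {n : ℕ → ℕ} (hH : IsModelTree H y₀ n) (y : W) :
    outerDegree H y₀ y = n (H.dist y₀ y) := by
  have h := degree_eq_outerDegree_add_innerDegree y₀ hH.isTree y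
  by_cases hy : y = y₀
  · subst hy
    rw [innerDegree_self, hH.degree_root] at h
    rw [SimpleGraph.dist_self]
    omega
  · rw [innerDegree_eq_one_of_isTree y₀ hH.isTree hy,
      hH.degree_of_pos _ (hH.isTree.connected.pos_dist_of_ne (Ne.symm hy)) y rfl] at h
    omega

/-- An infinite, locally finite, connected graph has no empty sphere, so some vertex at distance `r`
has an outer neighbour. -/
theorem IsModelTree.pos {W : Type*} {H : SimpleGraph W} [H.LocallyFinite] [Infinite W] {y₀ : W}
    {n : ℕ → ℕ} (hH : IsModelTree H y₀ n) (r : ℕ) : 0 < n r := by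
  obtain ⟨y, hy⟩ := exists_dist_eq (x₀ := y₀) hH.isTree.connected (r + 1)
  obtain ⟨z, hyz, hz⟩ := exists_inner (x₀ := y₀) hH.isTree.connected (x := y)
    (by rintro rfl; simp at hy)
  have h := outerDegree_pos H y₀ hyz.symm hz.symm
  rwa [hH.outerDegree_eq, show H.dist y₀ z = r by omega] at h

theorem IsModelTree.exists_radialHeatKernel_eq {W : Type*} {H : SimpleGraph W} [H.LocallyFinite]
    [Infinite W] {y₀ : W} {n : ℕ → ℕ} (hH : IsModelTree H y₀ n) (t : ℝ) (r : ℕ) :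
    ∃ y, H.dist y₀ y = r ∧ radialHeatKernel H y₀ t r = heatKernel H y₀ t y₀ y := by
  have h := exists_dist_eq (x₀ := y₀) hH.isTree.connected r
  exact ⟨h.choose, h.choose_spec, dif_pos h⟩

theorem IsModelTree.heatKernel_le {W : Type*} {H : SimpleGraph W} [H.LocallyFinite]
    [Infinite W] {y₀ : W} {n : ℕ → ℕ} (hH : IsModelTree H y₀ n)
    {V : Type*} {G : SimpleGraph V} [G.LocallyFinite] {x₀ : V} (hG : G.Connected)
    (hin : ∀ x : V, x ≠ x₀ → innerDegree G x₀ x = 1)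
    (hout : ∀ x, n (G.dist x₀ x) ≤ outerDegree G x₀ x)
    (t : ℝ) (ht : 0 ≤ t) (r : ℕ) (x : V) (hx : G.dist x₀ x = r) :
    heatKernel G x₀ t x₀ x ≤ radialHeatKernel H y₀ t r := by
  obtain ⟨y, hy, hyr⟩ := hH.exists_radialHeatKernel_eq t r
  rw [hyr]
  exact heatKernel_le_model hH.isTree.connected
    (fun y hy => innerDegree_eq_one_of_isTree y₀ hH.isTree hy) hH.outerDegree_eq hH.pos hG hin
    hout ht (hx.trans hy.symm)

end Tree

end GraphHeat

/-! ### The comparison theorem. -/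

theorem mainTheorem8 {W : Type*} (H : SimpleGraph W) [H.LocallyFinite] [Infinite W]
    (y₀ : W) (n : ℕ → ℕ) (hH : GraphHeat.IsModelTree H y₀ n) :
    -- the heat kernel of the model tree is constant on spheres about the root
    (∀ t : ℝ, 0 ≤ t → ∀ (r : ℕ) (y : W), H.dist y₀ y = r →
      GraphHeat.heatKernel H y₀ t y₀ y = GraphHeat.radialHeatKernel H y₀ t r) ∧
    -- comparison with a tree
    (∀ {V : Type*} (T : SimpleGraph V) [T.LocallyFinite] (x₀ : V), T.IsTree →
      n 0 ≤ T.degree x₀ →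
      (∀ r : ℕ, 0 < r → n r + 1 ≤ GraphHeat.minValence T x₀ r) →
      (∃ f : H →g T, Function.Injective f ∧ f y₀ = x₀) ∧
      ∀ t : ℝ, 0 ≤ t → ∀ (r : ℕ) (x : V), T.dist x₀ x = r →
        GraphHeat.heatKernel T x₀ t x₀ x ≤ GraphHeat.radialHeatKernel H y₀ t r) ∧
    -- comparison with a graph all of whose vertices other than `x₀` have one inner neighbour
    (∀ {V : Type*} (G : SimpleGraph V) [G.LocallyFinite] (x₀ : V), G.Connected →
      (∀ x : V, x ≠ x₀ → GraphHeat.innerDegree G x₀ x = 1) →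
      (∀ (r : ℕ) (x : V), G.dist x₀ x = r → n r ≤ GraphHeat.outerDegree G x₀ x) →
      ∀ t : ℝ, 0 ≤ t → ∀ (r : ℕ) (x : V), G.dist x₀ x = r →
        GraphHeat.heatKernel G x₀ t x₀ x ≤ GraphHeat.radialHeatKernel H y₀ t r) := by
  open GraphHeat in
  have hHc := hH.isTree.connected
  have hHin : ∀ y, y ≠ y₀ → innerDegree H y₀ y = 1 := fun y hy =>
    innerDegree_eq_one_of_isTree y₀ hH.isTree hy
  refine ⟨fun t ht r y hy => ?_, fun T _ x₀ hT hn0 hn => ?_, fun G _ x₀ hG hin hout =>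
    hH.heatKernel_le hG hin fun x => hout _ x rfl⟩
  · obtain ⟨z, hz, hzr⟩ := hH.exists_radialHeatKernel_eq t r
    rw [hzr]
    -- Radial symmetry: the model tree is compared with itself, in both directions.
    exact le_antisymm
      (heatKernel_le_model hHc hHin hH.outerDegree_eq hH.pos hHc hHin
        (fun y => (hH.outerDegree_eq y).ge) ht (hy.trans hz.symm))
      (heatKernel_le_model hHc hHin hH.outerDegree_eq hH.pos hHc hHin
        (fun y => (hH.outerDegree_eq y).ge) ht (hz.trans hy.symm))
  · have hin : ∀ x, x ≠ x₀ → innerDegree T x₀ x = 1 := fun x hx =>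
      innerDegree_eq_one_of_isTree x₀ hT hx
    have hout : ∀ x, n (T.dist x₀ x) ≤ outerDegree T x₀ x := by
      intro x
      have h := degree_eq_outerDegree_add_innerDegree x₀ hT x
      by_cases hx : x = x₀
      · subst hx
        rw [innerDegree_self] at h
        rw [SimpleGraph.dist_self]
        omega
      · rw [hin x hx] at h
        have h1 := hn _ (hT.connected.pos_dist_of_ne (Ne.symm hx))
        have h2 : minValence T x₀ (T.dist x₀ x) ≤ T.degree x := Nat.sInf_le ⟨x, rfl, rfl⟩
        omega
    exact ⟨exists_tree_embedding x₀ hH.isTree hin fun y x hyx => by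
      rw [hH.outerDegree_eq, hyx]; exact hout x, hH.heatKernel_le hT.connected hin hout⟩
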